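/- **Notation.** Let $(\mathbb K,d)=(\mathbb C,3)$ (complex case) or $(\mathbb R,2)$ (real case). Identify $S^{d-1}$ with $\mathbb K\cup\{\infty\}=\mathbb{KP}^1$ by stereographic projection from the north pole ($(x,y,z)\mapsto (x+iy)/(1-z)$, respectively $(x,y)\mapsto x/(1-y)$). Let $\mathbb{KP}^\infty$ be the projectivization of the polynomial space $\mathbb K[t]$ (a model of $BU(1)$, respectively $BO(1)$), with the commutative product $[f][g]=[fg]$; let $\mathbb{KP}^{n-1}\subset\mathbb{KP}^\infty$ be the set of lines of polynomials of degree $\le n-1$, and $\mathbb{KP}^1\subset\mathbb{KP}^\infty$ via $z\mapsto[u_z]$, where $u_z=t-z$ for $z\in\mathbb K$ and $u_\infty=1$. Points of $\mathbb{KP}^\infty$ are projectively independent if representatives are linearly independent. For a configuration $p=(p_1,\dots,p_n)\in\mathrm{Conf}_n(\mathbb R^d)$ of distinct points, let $x_{i,j}=(p_j-p_i)/\|p_j-p_i\|\in S^{d-1}$, regarded in $\mathbb{KP}^1\subset\mathbb{KP}^\infty$, let $\ell_i(p)=\prod_{j\ne i}x_{i,j}\in\mathbb{KP}^{n-1}$,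 let $v_i=\prod_{j\neq i}u_{x_{i,j}}\in\mathbb K[t]_{\le n-1}\cong\mathbb K^n$, let $\varphi(p)$ be the determinant of the matrix with columns the coefficient vectors of $v_1,\dots,v_n$, and $$D(p)=\frac{\varphi(p)}{\prod_{i<j}\varphi(p_i,p_j)} .$$ For a Euclidean space $E$, let $FM_E(n)$ be the Fulton–MacPherson space: the closure, in the product of copies of the unit sphere $S(E)$ (one for each pair of distinct indices) and of $[0,\infty]$ (one for each triple of distinct indices), of the set of points $\big((x_{i,j}),(\|p_i-p_j\|/\|p_i-p_k\|)\big)$ with $p\in\mathrm{Conf}_n(E)$. Put $FM_d=FM_{\mathbb R^d}$ and $FM_\infty=FM_{\mathbb R^\infty}$, where $\mathbb R^\infty$ is the space of finitely supported real sequences; then $FM_d(n)\subset FM_\infty(n)$. Let $\gamma$ be the operadic composition: in $\gamma(p;q^{(1)},\dots,q^{(n)})$ the $i$-th point of $p$ is replaced by an infinitesimally small copy of $q^{(i)}$. Let $D_n(\mathbb{KP}^\infty)=FM_\infty(n)\times_{\Sigma_n}(\mathbb{KP}^\infty)^n$, and let $F_n^{\mathbb K}\subseteq D_n(\mathbb{KP}^\infty)$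 be the set of classes $[q;y_1,\dots,y_n]$ such that $y_1,\dots,y_n$ lie in $\mathbb{KP}^{n-1}$ and are projectively independent. For $k_1,\dots,k_n\in\mathbb N$ and $K=\sum_i k_i$ define $$\nu_{n:k_1,\dots,k_n}\colon FM_d(n)\times\prod_{i=1}^n D_{k_i}(\mathbb{KP}^\infty)\to D_K(\mathbb{KP}^\infty),\qquad (p,([q^{(i)};y_{i,1},\dots,y_{i,k_i}])_i)\mapsto\big[\gamma(p;q^{(1)},\dots,q^{(n)});(a_i\,y_{i,j})_{i,j}\big],$$ where $a_i=\prod_{h\ne i}x_{i,h}(p)^{k_h}\in\mathbb{KP}^\infty$ is the $i$-th component of the Atiyah map with weights $(k_1,\dots,k_n)$, and the pairs $(i,j)$ are ordered lexicographically. Consider the following statements. * **Weak conjecture:** for all $n$ and all $p\in\mathrm{Conf}_n(\mathbb R^d)$, the lines $\ell_1(p),\dots,\ell_n(p)$ are projectively independent. * **Strong conjecture:** for all $n$ and all $p\in\mathrm{Conf}_n(\mathbb R^d)$, $|D(p)|\ge1$. * **$E_d$ conjecture:** for all $n$ and all $k_1,\dots,k_n\in\mathbb N$, $\ \nu_{n:k_1,\dots,k_n}\big(FM_d(n)\times\prod_{i=1}^nF^{\mathbb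 K}_{k_i}\big)\subseteq F^{\mathbb K}_K$. **Theorem.** 1. (Complex case, $\mathbb K=\mathbb C$, $d=3$.) If the strong Atiyah–Sutcliffe conjecture is true, then so is the $E_3$ one. 2. (Complex case.) If the $E_3$ Atiyah–Sutcliffe conjecture is true, then so is the weak one. 3. (Real case, $\mathbb K=\mathbb R$, $d=2$.) If the strong real Atiyah–Sutcliffe conjecture is true, then so is the $E_2$ one. 4. (Real case.) If the $E_2$ real Atiyah–Sutcliffe conjecture is true, then so is the weak real one. -/

import Mathlib

open Polynomial Filter Topology
open scoped ENNReal

set_option linter.unusedSectionVars false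

noncomputable section

/-! ## Fulton–MacPherson spaces -/

/-- The configuration space of distinct points of `E` labelled by `ι`. -/
abbrev Conf (E ι : Type*) := ι ↪ E

/-- Ordered pairs of distinct indices. -/
abbrev Pairs (ι : Type*) := {e : ι × ι // e.1 ≠ e.2}

/-- Ordered triples of pairwise distinct indices. -/
abbrev Triples (ι : Type*) :=
  {e : ι × ι × ι // e.1 ≠ e.2.1 ∧ e.1 ≠ e.2.2 ∧ e.2.1 ≠ e.2.2}

/-- The unit sphere of `E`. -/
abbrev USphere (E : Type*) [NormedAddCommGroup E] := Metric.sphere (0 : E) 1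

/-- The space `∏_{(i,j)} S(E) × ∏_{(i,j,k)} [0,∞]` in which the Fulton–MacPherson space is a closed
subspace: a direction for every pair, a ratio of distances for every triple. -/
abbrev Amb (E ι : Type*) [NormedAddCommGroup E] :=
  (Pairs ι → USphere E) × (Triples ι → ℝ≥0∞)

section FM

variable {E : Type*} [NormedAddCommGroup E] [NormedSpace ℝ E]

/-- The directions `x_{i,j} = (p_j - p_i) / ‖p_j - p_i‖` of a configuration. -/
def confDir {ι : Type*} (p : Conf E ι) (e : Pairs ι) : USphere E :=
  ⟨‖p e.1.2 - p e.1.1‖⁻¹ • (p e.1.2 - p e.1.1), by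
    have h : p e.1.2 - p e.1.1 ≠ 0 := sub_ne_zero.2 fun h => e.2 (p.injective h).symm
    rw [mem_sphere_zero_iff_norm, norm_smul, norm_inv, norm_norm]
    exact inv_mul_cancel₀ (norm_ne_zero_iff.2 h)⟩

/-- The coordinates of a configuration: the directions `x_{i,j}` and the ratios
`‖p_i - p_j‖ / ‖p_i - p_k‖`. They determine it up to translations and positive dilations. -/
def confPt {ι : Type*} (p : Conf E ι) : Amb E ι :=
  (confDir p, fun e =>
    ENNReal.ofReal (‖p e.1.1 - p e.1.2.1‖ / ‖p e.1.1 - p e.1.2.2‖))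

/-- The Fulton–MacPherson space `FM_E(ι)`: the closure of the configurations in `Amb E ι`. -/
def FM (E ι : Type*) [NormedAddCommGroup E] [NormedSpace ℝ E] : Type _ :=
  {x : Amb E ι // x ∈ closure (Set.range (confPt (E := E) (ι := ι)))}

/-- The canonical map from configurations to the Fulton–MacPherson space. -/
def FM.ofConf {ι : Type*} (p : Conf E ι) : FM E ι :=
  ⟨confPt p, subset_closure ⟨p, rfl⟩⟩

/-- The direction `x_{i,j}`, extended to the Fulton–MacPherson space. -/
def FM.dir {ι : Type*} (p : FM E ι) : Pairs ι → USphere E := p.1.1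

/-! ### Relabelling -/

/-- Restriction of coordinates along an injection of index sets. -/
def Amb.reindex {ι κ : Type*} (f : ι ↪ κ) (x : Amb E κ) : Amb E ι :=
  (fun e => x.1 ⟨(f e.1.1, f e.1.2), fun h => e.2 (f.injective h)⟩,
   fun e => x.2 ⟨(f e.1.1, f e.1.2.1, f e.1.2.2),
     fun h => e.2.1 (f.injective h), fun h => e.2.2.1 (f.injective h),
     fun h => e.2.2.2 (f.injective h)⟩)

theorem Amb.continuous_reindex {ι κ : Type*} (f : ι ↪ κ) :
    Continuous (Amb.reindex f : Amb E κ → Amb E ι) := by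
  unfold Amb.reindex
  fun_prop

/-- Relabelling (and forgetting) points of the Fulton–MacPherson space along an injection. For
permutations this is the (right) action of the symmetric group. -/
def FM.reindex {ι κ : Type*} (f : ι ↪ κ) (x : FM E κ) : FM E ι :=
  ⟨Amb.reindex f x.1, map_mem_closure (Amb.continuous_reindex f) x.2 (by
    rintro _ ⟨p, rfl⟩
    exact ⟨f.trans p, rfl⟩)⟩

/-! ### Change of ambient space -/

/-- The map on coordinates induced by a linear isometric embedding. -/
def Amb.map {F : Type*} [NormedAddCommGroup F] [NormedSpace ℝ F] (f : E →ₗᵢ[ℝ] F) {ι : Type*}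
    (x : Amb E ι) : Amb F ι :=
  (fun e => ⟨f (x.1 e), by
    rw [mem_sphere_zero_iff_norm, f.norm_map]; exact norm_eq_of_mem_sphere _⟩, x.2)

/-- The map of Fulton–MacPherson spaces induced by a linear isometric embedding. -/
def FM.map {F : Type*} [NormedAddCommGroup F] [NormedSpace ℝ F] (f : E →ₗᵢ[ℝ] F) {ι : Type*}
    (x : FM E ι) : FM F ι :=
  ⟨Amb.map f x.1, map_mem_closure (f := Amb.map f)
    (by
      have := f.continuous
      unfold Amb.map
      refine Continuous.prodMk (continuous_pi fun e => Continuous.subtype_mk ?_ _) ?_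
      · fun_prop
      · fun_prop) x.2 (by
    rintro _ ⟨p, rfl⟩
    refine ⟨p.trans ⟨f, f.injective⟩, ?_⟩
    refine Prod.ext (funext fun e => Subtype.ext ?_) (funext fun e => ?_)
    · simp [confPt, confDir, Amb.map, ← map_sub]
    · simp [confPt, Amb.map, ← map_sub])⟩

/-! ### Operadic composition -/

theorem Sigma.ne_cast {ι : Type*} {κ : ι → Type*} {x y : Σ i, κ i} (hne : x ≠ y)
    (h : y.1 = x.1) : x.2 ≠ h ▸ y.2 := by
  rcases x with ⟨i, a⟩
  rcases y with ⟨j, b⟩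
  dsimp only at h
  subst h
  rintro rfl
  exact hne rfl

theorem Sigma.cast_ne_cast {ι : Type*} {κ : ι → Type*} {y z : Σ i, κ i} {i : ι} (hne : y ≠ z)
    (hy : y.1 = i) (hz : z.1 = i) : (hy ▸ y.2 : κ i) ≠ hz ▸ z.2 := by
  subst hy
  exact Sigma.ne_cast hne hz

open Classical in
/-- Operadic composition in coordinates: the configuration `q i`, made infinitesimally small,
replaces the `i`-th point of `p`. -/
def Amb.comp {ι : Type*} {κ : ι → Type*} (p : Amb E ι) (q : ∀ i, Amb E (κ i)) :
    Amb E (Σ i, κ i) :=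
  (fun e =>
    if h : e.1.2.1 = e.1.1.1 then
      (q e.1.1.1).1 ⟨(e.1.1.2, h ▸ e.1.2.2), Sigma.ne_cast e.2 h⟩
    else p.1 ⟨(e.1.1.1, e.1.2.1), Ne.symm h⟩,
   fun e =>
    if hy : e.1.2.1.1 = e.1.1.1 then
      if hz : e.1.2.2.1 = e.1.1.1 then
        (q e.1.1.1).2 ⟨(e.1.1.2, hy ▸ e.1.2.1.2, hz ▸ e.1.2.2.2),
          Sigma.ne_cast e.2.1 hy, Sigma.ne_cast e.2.2.1 hz, Sigma.cast_ne_cast e.2.2.2 hy hz⟩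
      else 0
    else
      if hz : e.1.2.2.1 = e.1.1.1 then ∞
      else
        if hyz : e.1.2.1.1 = e.1.2.2.1 then 1
        else p.2 ⟨(e.1.1.1, e.1.2.1.1, e.1.2.2.1), Ne.symm hy, Ne.symm hz, hyz⟩)

theorem Amb.continuous_comp {ι : Type*} {κ : ι → Type*} :
    Continuous (fun z : Amb E ι × (∀ i, Amb E (κ i)) => Amb.comp z.1 z.2) := by
  unfold Amb.comp
  refine Continuous.prodMk (continuous_pi fun e => ?_) (continuous_pi fun e => ?_)
  · split_ifs <;> fun_prop
  · split_ifs <;> fun_prop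

/-- The composition of coordinates of configurations is a limit of coordinates of configurations
`P_i + ε Q^i_a`, for `ε → 0`. -/
theorem Amb.comp_confPt_mem {ι : Type*} [Finite ι] {κ : ι → Type*} [∀ i, Finite (κ i)]
    (P : Conf E ι) (Q : ∀ i, Conf E (κ i)) :
    Amb.comp (confPt P) (fun i => confPt (Q i)) ∈
      closure (Set.range (confPt (E := E) (ι := Σ i, κ i))) := by
  set c : ℝ → (Σ i, κ i) → E := fun ε x => P x.1 + ε • Q x.1 x.2 with hc
  have hcont : ∀ x, Tendsto (fun ε => c ε x) (𝓝[>] 0) (𝓝 (P x.1)) := by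
    intro x
    have : Continuous fun ε : ℝ => c ε x := by fun_prop
    simpa [hc] using (this.tendsto 0).mono_left nhdsWithin_le_nhds
  have hsub : ∀ x y : Σ i, κ i, Tendsto (fun ε => c ε x - c ε y) (𝓝[>] 0) (𝓝 (P x.1 - P y.1)) :=
    fun x y => (hcont x).sub (hcont y)
  have hP : ∀ i j, i ≠ j → P i - P j ≠ 0 := fun i j h => sub_ne_zero.2 fun h' => h (P.injective h')
  have hsame : ∀ (i : ι) (a b : κ i) (ε : ℝ), c ε ⟨i, a⟩ - c ε ⟨i, b⟩ = ε • (Q i a - Q i b) := by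
    intro i a b ε
    simp [hc, smul_sub]
  have hpos : ∀ᶠ ε : ℝ in 𝓝[>] 0, 0 < ε := self_mem_nhdsWithin
  have hinj : ∀ᶠ ε : ℝ in 𝓝[>] 0, Function.Injective (c ε) := by
    have : ∀ᶠ ε : ℝ in 𝓝[>] 0, ∀ x y : Σ i, κ i, x ≠ y → c ε x - c ε y ≠ 0 := by
      refine eventually_all.2 fun x => eventually_all.2 fun y => ?_
      by_cases hxy : x = y
      · simp [hxy]
      · rcases x with ⟨i, a⟩
        rcases y with ⟨j, b⟩
        by_cases hij : i = j
        · subst hij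
          filter_upwards [hpos] with ε hε _
          rw [hsame]
          refine smul_ne_zero hε.ne' (sub_ne_zero.2 fun h => hxy ?_)
          rw [(Q i).injective h]
        · filter_upwards [(hsub ⟨i, a⟩ ⟨j, b⟩).eventually_ne (hP i j hij)] with ε hε _
          exact hε
    filter_upwards [this] with ε hε x y hxy
    by_contra hne
    exact hε x y hne (sub_eq_zero.2 hxy)
  obtain ⟨u, hu⟩ : ∃ u : ℕ → ℝ, Tendsto u atTop (𝓝[>] 0) ∧ ∀ n, 0 < u n ∧
      Function.Injective (c (u n)) := by
    obtain ⟨u, hu, hmem⟩ := Filter.exists_seq_forall_of_frequently (hpos.and hinj).frequently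
    exact ⟨u, hu, hmem⟩
  obtain ⟨hu, hmem⟩ := hu
  refine mem_closure_of_tendsto (b := atTop) (f := fun n => confPt ⟨c (u n), (hmem n).2⟩) ?_
    (Eventually.of_forall fun n => ⟨_, rfl⟩)
  have hsub' := fun x y => (hsub x y).comp hu
  rw [nhds_prod_eq]
  refine Tendsto.prodMk (tendsto_pi_nhds.2 ?_) (tendsto_pi_nhds.2 ?_)
  · rintro ⟨⟨⟨i, a⟩, ⟨j, b⟩⟩, h⟩
    by_cases hij : j = i
    · subst hij
      refine tendsto_const_nhds.congr fun n => Subtype.ext ?_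
      have := (hmem n).1
      simp only [Amb.comp, confPt, confDir, Function.Embedding.coeFn_mk, hsame, dif_pos]
      rw [norm_smul, Real.norm_of_nonneg this.le, smul_smul]
      congr 1
      field_simp
    · rw [tendsto_subtype_rng]
      simp only [Amb.comp, confPt, confDir, Function.Embedding.coeFn_mk, dif_neg hij]
      have := hsub' ⟨j, b⟩ ⟨i, a⟩
      exact (this.norm.inv₀ (norm_ne_zero_iff.2 (hP _ _ hij))).smul this
  · rintro ⟨⟨⟨i, a⟩, ⟨j, b⟩, ⟨k, d⟩⟩, h1, h2, h3⟩
    by_cases hj : j = i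
    · subst hj
      by_cases hk : k = j
      · subst hk
        refine tendsto_const_nhds.congr fun n => ?_
        have := (hmem n).1
        simp only [Amb.comp, confPt, Function.Embedding.coeFn_mk, hsame, dif_pos]
        rw [norm_smul, norm_smul, mul_div_mul_left _ _ (by simpa using this.ne')]
      · simp only [Amb.comp, confPt, Function.Embedding.coeFn_mk, dif_pos, dif_neg hk]
        rw [← ENNReal.ofReal_zero]
        refine ENNReal.tendsto_ofReal ?_
        have h := (hsub' ⟨j, a⟩ ⟨j, b⟩).norm.div (hsub' ⟨j, a⟩ ⟨k, d⟩).norm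
          (norm_ne_zero_iff.2 (hP _ _ (Ne.symm hk)))
        rw [sub_self, norm_zero, zero_div] at h
        exact h
    · by_cases hk : k = i
      · subst hk
        simp only [Amb.comp, confPt, Function.Embedding.coeFn_mk, dif_pos, dif_neg hj]
        refine ENNReal.tendsto_ofReal_atTop.comp ?_
        have hden : Tendsto (fun n => ‖c (u n) ⟨k, a⟩ - c (u n) ⟨k, d⟩‖) atTop (𝓝[>] 0) := by
          refine tendsto_nhdsWithin_iff.2 ⟨?_, Eventually.of_forall fun n => ?_⟩
          · simpa using (hsub' ⟨k, a⟩ ⟨k, d⟩).norm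
          · exact norm_pos_iff.2 (sub_ne_zero.2 fun h => h2 ((hmem n).2 h))
        have hnum := (hsub' ⟨k, a⟩ ⟨j, b⟩).norm
        simp only [div_eq_mul_inv]
        exact Tendsto.pos_mul_atTop (norm_pos_iff.2 (hP _ _ (Ne.symm hj))) hnum
          (tendsto_inv_nhdsGT_zero.comp hden)
      · have hlim := ENNReal.tendsto_ofReal ((hsub' ⟨i, a⟩ ⟨j, b⟩).norm.div
          (hsub' ⟨i, a⟩ ⟨k, d⟩).norm (norm_ne_zero_iff.2 (hP _ _ (Ne.symm hk))))
        by_cases hjk : j = k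
        · subst hjk
          simp only [Amb.comp, confPt, Function.Embedding.coeFn_mk, dif_pos, dif_neg hj]
          simpa [div_self (norm_ne_zero_iff.2 (hP _ _ (Ne.symm hj)))] using hlim
        · simp only [Amb.comp, confPt, Function.Embedding.coeFn_mk, dif_neg hj, dif_neg hk,
            dif_neg hjk]
          exact hlim

/-- The operadic composition `γ` of the Fulton–MacPherson operad. -/
def FM.comp {ι : Type*} [Finite ι] {κ : ι → Type*} [∀ i, Finite (κ i)]
    (p : FM E ι) (q : ∀ i, FM E (κ i)) : FM E (Σ i, κ i) :=
  ⟨Amb.comp p.1 (fun i => (q i).1), by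
    have hz : ((p.1, fun i => (q i).1) : Amb E ι × (∀ i, Amb E (κ i))) ∈
        closure (Set.range (confPt (E := E) (ι := ι)) ×ˢ
          Set.univ.pi fun i => Set.range (confPt (E := E) (ι := κ i))) := by
      rw [closure_prod_eq, closure_pi_set]
      exact ⟨p.2, fun i _ => (q i).2⟩
    have := map_mem_closure (t := closure (Set.range (confPt (E := E) (ι := Σ i, κ i))))
      Amb.continuous_comp hz (by
        rintro ⟨x, y⟩ ⟨⟨P, rfl⟩, hy⟩
        choose Q hQ using fun i => hy i (Set.mem_univ i)
        obtain rfl : (fun i => confPt (Q i)) = y := funext hQ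
        exact Amb.comp_confPt_mem P Q)
    rwa [closure_closure] at this⟩

end FM

/-! ## The space `ℝ^∞` -/

/-- `ℝ^∞`: finitely supported real sequences with the Euclidean norm. -/
def RInf : Submodule ℝ (lp (fun _ : ℕ => ℝ) 2) where
  carrier := {x | (Function.support (x : ℕ → ℝ)).Finite}
  zero_mem' := by
    change (Function.support fun _ : ℕ => (0 : ℝ)).Finite
    simp
  add_mem' {x y} hx hy := (hx.union hy).subset
    (Function.support_add (x : ℕ → ℝ) (y : ℕ → ℝ))
  smul_mem' r x hx := hx.subset
    (Function.support_const_smul_subset r (x : ℕ → ℝ))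

/-- The `i`-th standard unit vector of `ℝ^∞`. -/
def RInf.unitVec (i : ℕ) : RInf :=
  ⟨lp.single 2 i (1 : ℝ), (Set.finite_singleton i).subset fun j hj => by
    by_contra h
    exact hj (by simp [lp.single_apply, show j ≠ i from h])⟩

theorem RInf.orthonormal_unitVec : Orthonormal ℝ RInf.unitVec := by
  rw [orthonormal_iff_ite]
  intro i j
  rw [Submodule.coe_inner]
  simp only [RInf.unitVec]
  rw [lp.inner_single_left]
  simp [lp.single_apply, Pi.single_apply]

/-- The standard inclusion `ℝ^d ⊆ ℝ^∞`. -/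
def toRInf (d : ℕ) : EuclideanSpace ℝ (Fin d) →ₗᵢ[ℝ] RInf :=
  ((EuclideanSpace.basisFun (Fin d) ℝ).toBasis.constr ℝ
    fun i => RInf.unitVec i).isometryOfOrthonormal
    (v := (EuclideanSpace.basisFun (Fin d) ℝ).toBasis)
    (by simp)
    (by
      have : (((EuclideanSpace.basisFun (Fin d) ℝ).toBasis.constr ℝ
          fun i : Fin d => RInf.unitVec i) ∘ (EuclideanSpace.basisFun (Fin d) ℝ).toBasis) =
          RInf.unitVec ∘ ((↑) : Fin d → ℕ) := by
        funext i
        simp only [Function.comp_apply, Module.Basis.constr_basis]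
      rw [this]
      exact RInf.orthonormal_unitVec.comp _ Fin.val_injective)

/-! ## Infinite projective space as the projectivization of the space of polynomials -/

/-- `𝕜P^∞`, the space of lines in `𝕜[t]`; it is a model of `BU(1)` for `𝕜 = ℂ` and of `BO(1)` for
`𝕜 = ℝ`. -/
abbrev PInf (𝕜 : Type*) [Field 𝕜] := Projectivization 𝕜 𝕜[X]

section PInf

variable {𝕜 : Type*} [Field 𝕜]

/-- The monoid structure `[f] * [g] = [f g]` of `𝕜P^∞`. -/
instance PInf.instMul : Mul (PInf 𝕜) :=
  ⟨fun x y => Projectivization.mk 𝕜 (x.rep * y.rep) (mul_ne_zero x.rep_nonzero y.rep_nonzero)⟩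

theorem PInf.mk_mul_mk (f g : 𝕜[X]) (hf : f ≠ 0) (hg : g ≠ 0) :
    (Projectivization.mk 𝕜 f hf * Projectivization.mk 𝕜 g hg : PInf 𝕜) =
      Projectivization.mk 𝕜 (f * g) (mul_ne_zero hf hg) := by
  obtain ⟨a, ha⟩ := Projectivization.exists_smul_eq_mk_rep 𝕜 f hf
  obtain ⟨b, hb⟩ := Projectivization.exists_smul_eq_mk_rep 𝕜 g hg
  refine (Projectivization.mk_eq_mk_iff 𝕜 _ _ _ _).2 ⟨a * b, ?_⟩
  rw [← ha, ← hb, smul_mul_smul_comm]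

instance PInf.instCommMonoid : CommMonoid (PInf 𝕜) where
  one := Projectivization.mk 𝕜 1 one_ne_zero
  mul_assoc x y z := by
    induction x using Projectivization.ind with | h f hf =>
    induction y using Projectivization.ind with | h g hg =>
    induction z using Projectivization.ind with | h k hk =>
    simp only [PInf.mk_mul_mk, mul_assoc]
  one_mul x := by
    induction x using Projectivization.ind with | h f hf =>
    exact (PInf.mk_mul_mk 1 f one_ne_zero hf).trans (by simp only [one_mul])
  mul_one x := by
    induction x using Projectivization.ind with | h f hf =>
    exact (PInf.mk_mul_mk f 1 hf one_ne_zero).trans (by simp only [mul_one])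
  mul_comm x y := by
    induction x using Projectivization.ind with | h f hf =>
    induction y using Projectivization.ind with | h g hg =>
    simp only [PInf.mk_mul_mk, mul_comm]

/-- `𝕜P^{n-1} ⊆ 𝕜P^∞`: the lines of polynomials of degree at most `n - 1`. -/
def PFin (𝕜 : Type*) [Field 𝕜] (n : ℕ) : Set (PInf 𝕜) :=
  {x | x.submodule ≤ degreeLT 𝕜 n}

/-- The representative of a point of `𝕜P^1 = 𝕜 ∪ {∞}`, seen as a polynomial of degree at most `1`:
the point `z` is represented by `t - z`, the point `∞` by `1`. -/
def rootPoly : OnePoint 𝕜 → 𝕜[X]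
  | none => 1
  | some z => X - C z

theorem rootPoly_ne_zero (z : OnePoint 𝕜) : rootPoly z ≠ 0 := by
  cases z with
  | infty => exact one_ne_zero
  | coe z => exact X_sub_C_ne_zero z

/-- The inclusion `𝕜P^1 ⊆ 𝕜P^∞`. -/
def rootLine (z : OnePoint 𝕜) : PInf 𝕜 :=
  Projectivization.mk 𝕜 (rootPoly z) (rootPoly_ne_zero z)

end PInf

open Classical in
/-- Stereographic projection `S² → ℂ ∪ {∞}` from the north pole. -/
def stereoC (x : USphere (EuclideanSpace ℝ (Fin 3))) : OnePoint ℂ :=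
  if x.1 2 = 1 then OnePoint.infty
  else ((((x.1 0 : ℝ) + (x.1 1 : ℝ) * Complex.I) / (1 - (x.1 2 : ℝ)) : ℂ) : OnePoint ℂ)

open Classical in
/-- Stereographic projection `S¹ → ℝ ∪ {∞}` from the north pole. -/
def stereoR (x : USphere (EuclideanSpace ℝ (Fin 2))) : OnePoint ℝ :=
  if x.1 1 = 1 then OnePoint.infty else ((x.1 0 / (1 - x.1 1) : ℝ) : OnePoint ℝ)

/-! ## The Atiyah map and the normalized determinant -/

section Atiyah

variable {𝕜 : Type*} [Field 𝕜] {E : Type*} [NormedAddCommGroup E] [NormedSpace ℝ E]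

/-- `(∏_{j ≠ i} x_{i,j}^{w_j})_i` for a family of directions `x`. -/
def weightedLines (s : USphere E → OnePoint 𝕜) {n : ℕ} (w : Fin n → ℕ)
    (x : Pairs (Fin n) → USphere E) (i : Fin n) : PInf 𝕜 :=
  ∏ j : {j : Fin n // j ≠ i}, rootLine (s (x ⟨(i, j), j.2.symm⟩)) ^ w j

/-- The lines `ℓ_1, …, ℓ_n` of a configuration. -/
def atiyahLines (s : USphere E → OnePoint 𝕜) {n : ℕ} (p : Conf E (Fin n)) : Fin n → PInf 𝕜 :=
  weightedLines s (fun _ => 1) (confDir p)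

/-- The weighted Atiyah map, extended to the Fulton–MacPherson space. -/
def weightedAtiyah (s : USphere E → OnePoint 𝕜) {n : ℕ} (w : Fin n → ℕ) (p : FM E (Fin n)) :
    Fin n → PInf 𝕜 :=
  weightedLines s w p.dir

/-- The polynomial `v_i = ∏_{j ≠ i} u_{i,j}`, of degree at most `n - 1`, where `u_{i,j}` is the
chosen representative of the point of `𝕜P^1` given by `x_{i,j}`. -/
def atiyahPoly (s : USphere E → OnePoint 𝕜) {n : ℕ} (p : Conf E (Fin n)) (i : Fin n) : 𝕜[X] :=
  ∏ j : {j : Fin n // j ≠ i}, rootPoly (s (confDir p ⟨(i, j), j.2.symm⟩))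

/-- `φ(p_1, …, p_n)`: the determinant of the matrix whose columns are the coefficients of the
`v_i`. -/
def phi (s : USphere E → OnePoint 𝕜) {n : ℕ} (p : Conf E (Fin n)) : 𝕜 :=
  (Matrix.of fun a i : Fin n => (atiyahPoly s p i).coeff a).det

/-- `φ_I = φ(p_{i_1}, …, p_{i_r})` for `I = {i_1 < ⋯ < i_r}`. -/
def phiSub (s : USphere E → OnePoint 𝕜) {n : ℕ} (p : Conf E (Fin n)) (I : Finset (Fin n)) : 𝕜 :=
  phi s ((I.orderEmbOfFin rfl).toEmbedding.trans p)

/-- The normalized determinant `D = φ / ∏_{|I| = 2} φ_I`. -/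
def normDet (s : USphere E → OnePoint 𝕜) {n : ℕ} (p : Conf E (Fin n)) : 𝕜 :=
  phi s p / ∏ I ∈ (Finset.univ : Finset (Fin n)).powersetCard 2, phiSub s p I

end Atiyah

/-! ## Extended symmetric powers -/

/-- `(p, x) ~ (σ^* p, σ^* x)` for permutations `σ`. -/
def extSymSetoid (n : ℕ) (B : Type*) : Setoid (FM RInf (Fin n) × (Fin n → B)) where
  r a b := ∃ σ : Equiv.Perm (Fin n), b.1 = a.1.reindex σ.toEmbedding ∧ b.2 = a.2 ∘ σ
  iseqv :=
    { refl := fun a => ⟨1, rfl, rfl⟩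
      symm := by
        rintro ⟨a, x⟩ ⟨b, y⟩ ⟨σ, h1, h2⟩
        dsimp only at h1 h2
        subst h1 h2
        refine ⟨σ⁻¹, Subtype.ext (Prod.ext (funext fun e => ?_) (funext fun e => ?_)),
          funext fun i => ?_⟩
        · simp [FM.reindex, Amb.reindex]
        · simp [FM.reindex, Amb.reindex]
        · simp
      trans := by
        rintro ⟨a, x⟩ ⟨b, y⟩ ⟨c, z⟩ ⟨σ, h1, h2⟩ ⟨τ, h3, h4⟩
        dsimp only at h1 h2 h3 h4
        subst h1 h2 h3 h4
        exact ⟨σ * τ, rfl, rfl⟩ }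

/-- The extended symmetric power `D_n(B) = FM_∞(n) ×_{Σ_n} B^n`. -/
def ExtSym (n : ℕ) (B : Type*) : Type _ := Quotient (extSymSetoid n B)

/-- The class of a labelled point of `FM_∞(n)` in `D_n(B)`. -/
def ExtSym.mk {n : ℕ} {B : Type*} (p : FM RInf (Fin n)) (x : Fin n → B) : ExtSym n B :=
  Quotient.mk (extSymSetoid n B) (p, x)

section Action

variable {𝕜 : Type*} [Field 𝕜] {d : ℕ}

/-- The formula of the structure map on representatives: compose in `FM_∞`, and multiply the labels
of the `i`-th block by the `i`-th component of the Atiyah map with weights `k_1, …, k_n`. -/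
def preNu (s : USphere (EuclideanSpace ℝ (Fin d)) → OnePoint 𝕜) {n : ℕ} (k : Fin n → ℕ)
    (p : FM (EuclideanSpace ℝ (Fin d)) (Fin n))
    (r : ∀ i, FM RInf (Fin (k i)) × (Fin (k i) → PInf 𝕜)) :
    FM RInf (Fin (∑ i, k i)) × (Fin (∑ i, k i) → PInf 𝕜) :=
  (((p.map (toRInf d)).comp fun i => (r i).1).reindex finSigmaFinEquiv.symm.toEmbedding,
   (fun m : Σ i, Fin (k i) => weightedAtiyah s k p m.1 * (r m.1).2 m.2) ∘ finSigmaFinEquiv.symm)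

theorem Amb.comp_reindex {ι : Type*} {κ : ι → Type*} {E : Type*} [NormedAddCommGroup E]
    [NormedSpace ℝ E] (p : Amb E ι) (q : ∀ i, Amb E (κ i)) (σ : ∀ i, Equiv.Perm (κ i)) :
    Amb.comp p (fun i => Amb.reindex (σ i).toEmbedding (q i)) =
      Amb.reindex (Equiv.sigmaCongrRight σ).toEmbedding (Amb.comp p q) := by
  refine Prod.ext (funext ?_) (funext ?_)
  · rintro ⟨⟨⟨i, a⟩, ⟨j, b⟩⟩, h⟩
    by_cases hij : j = i
    · subst hij
      simp [Amb.comp, Amb.reindex]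
    · simp [Amb.comp, Amb.reindex, hij]
  · rintro ⟨⟨⟨i, a⟩, ⟨j, b⟩, ⟨k, c⟩⟩, h1, h2, h3⟩
    by_cases hj : j = i
    · subst hj
      by_cases hk : k = j
      · subst hk
        simp [Amb.comp, Amb.reindex]
      · simp [Amb.comp, Amb.reindex, hk]
    · by_cases hk : k = i
      · subst hk
        simp [Amb.comp, Amb.reindex, hj]
      · by_cases hjk : j = k
        · subst hjk
          simp [Amb.comp, Amb.reindex, hj]
        · simp [Amb.comp, Amb.reindex, hj, hk, hjk]

theorem preNu_rel (s : USphere (EuclideanSpace ℝ (Fin d)) → OnePoint 𝕜) {n : ℕ} (k : Fin n → ℕ)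
    (p : FM (EuclideanSpace ℝ (Fin d)) (Fin n))
    (r r' : ∀ i, FM RInf (Fin (k i)) × (Fin (k i) → PInf 𝕜))
    (h : ∀ i, extSymSetoid (k i) (PInf 𝕜) (r i) (r' i)) :
    extSymSetoid (∑ i, k i) (PInf 𝕜) (preNu s k p r) (preNu s k p r') := by
  choose σ h1 h2 using h
  refine ⟨(finSigmaFinEquiv.symm.trans (Equiv.sigmaCongrRight σ)).trans finSigmaFinEquiv,
    Subtype.ext ?_, funext fun m => ?_⟩
  · have : (fun i => (r' i).1.1) =
        fun i => Amb.reindex (σ i).toEmbedding (r i).1.1 := by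
      funext i
      rw [h1 i]
      rfl
    simp only [preNu, FM.reindex, FM.comp, this, Amb.comp_reindex]
    simp [Amb.reindex]
  · refine Eq.trans ?_ (congrArg
      (fun m : Σ i, Fin (k i) => weightedAtiyah s k p m.1 * (r m.1).2 m.2)
      (Equiv.symm_apply_apply finSigmaFinEquiv _).symm)
    simp only [preNu, h2]
    rfl

/-- The structure map `ν_{n : k_1, …, k_n} : FM_d(n) × ∏ D_{k_i}(𝕜P^∞) → D_K(𝕜P^∞)`, where
`K = ∑ k_i`. -/
def nu (s : USphere (EuclideanSpace ℝ (Fin d)) → OnePoint 𝕜) {n : ℕ} (k : Fin n → ℕ)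
    (p : FM (EuclideanSpace ℝ (Fin d)) (Fin n)) (r : ∀ i, ExtSym (k i) (PInf 𝕜)) :
    ExtSym (∑ i, k i) (PInf 𝕜) :=
  ExtSym.mk (preNu s k p fun i => (r i).out).1 (preNu s k p fun i => (r i).out).2

/-- `nu` can be computed on arbitrary representatives. -/
theorem nu_mk (s : USphere (EuclideanSpace ℝ (Fin d)) → OnePoint 𝕜) {n : ℕ} (k : Fin n → ℕ)
    (p : FM (EuclideanSpace ℝ (Fin d)) (Fin n))
    (q : ∀ i, FM RInf (Fin (k i))) (y : ∀ i, Fin (k i) → PInf 𝕜) :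
    nu s k p (fun i => ExtSym.mk (q i) (y i)) =
      ExtSym.mk (preNu s k p fun i => (q i, y i)).1 (preNu s k p fun i => (q i, y i)).2 :=
  Quotient.sound (s := extSymSetoid _ _) (preNu_rel s k p _ _ fun i =>
    Quotient.mk_out (s := extSymSetoid (k i) (PInf 𝕜)) (q i, y i))

/-- The subspace `F_n ⊆ D_n(𝕜P^∞)` of the classes with labels projectively independent in
`𝕜P^{n-1} ⊆ 𝕜P^∞`. -/
def FSub (𝕜 : Type*) [Field 𝕜] (n : ℕ) : Set (ExtSym n (PInf 𝕜)) :=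
  {z | ∃ (p : FM RInf (Fin n)) (x : Fin n → PInf 𝕜), z = ExtSym.mk p x ∧
    (∀ i, x i ∈ PFin 𝕜 n) ∧ Projectivization.Independent x}

end Action

/-! ## The conjectures -/

/-- The weak Atiyah–Sutcliffe conjecture. -/
def WeakAtiyahSutcliffe : Prop :=
  ∀ (n : ℕ) (p : Conf (EuclideanSpace ℝ (Fin 3)) (Fin n)),
    Projectivization.Independent (atiyahLines stereoC p)

/-- The strong Atiyah–Sutcliffe conjecture. -/
def StrongAtiyahSutcliffe : Prop :=
  ∀ (n : ℕ) (p : Conf (EuclideanSpace ℝ (Fin 3)) (Fin n)), 1 ≤ ‖normDet stereoC p‖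

/-- The `E₃` Atiyah–Sutcliffe conjecture. -/
def E3AtiyahSutcliffe : Prop :=
  ∀ (n : ℕ) (k : Fin n → ℕ) (p : FM (EuclideanSpace ℝ (Fin 3)) (Fin n))
    (r : ∀ i, ExtSym (k i) (PInf ℂ)), (∀ i, r i ∈ FSub ℂ (k i)) →
    nu stereoC k p r ∈ FSub ℂ (∑ i, k i)

/-- The weak real Atiyah–Sutcliffe conjecture. -/
def WeakRealAtiyahSutcliffe : Prop :=
  ∀ (n : ℕ) (p : Conf (EuclideanSpace ℝ (Fin 2)) (Fin n)),
    Projectivization.Independent (atiyahLines stereoR p)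

/-- The strong real Atiyah–Sutcliffe conjecture. -/
def StrongRealAtiyahSutcliffe : Prop :=
  ∀ (n : ℕ) (p : Conf (EuclideanSpace ℝ (Fin 2)) (Fin n)), 1 ≤ ‖normDet stereoR p‖

/-- The `E₂` real Atiyah–Sutcliffe conjecture. -/
def E2RealAtiyahSutcliffe : Prop :=
  ∀ (n : ℕ) (k : Fin n → ℕ) (p : FM (EuclideanSpace ℝ (Fin 2)) (Fin n))
    (r : ∀ i, ExtSym (k i) (PInf ℝ)), (∀ i, r i ∈ FSub ℝ (k i)) →
    nu stereoR k p r ∈ FSub ℝ (∑ i, k i)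

end

/-!
The determinant `φ` depends only on the directions `x_{i,j}`, and rescaling the representatives
`u_{i,j}` of the points of `𝕜P^1` multiplies `φ(p)` and the product of the `φ(p_i, p_j)` by the same
scalar `∏ c_{i,j}` (`scaledDet_confDir`, `Pairs.prod_powersetCard_two`). The strong conjecture
therefore says `∏ ‖φ(p_i, p_j)‖ ≤ ‖φ(p)‖` for every choice of representatives
(`prod_norm_scaledDet_confDir_le`). The representatives `u_{i,j}` are discontinuous at the north
pole, but stereographic projection has two continuous lifts to `𝕜[t]` without common zeros
(`isLiftable_of_stereographic`). For either choice of lift at each pair both sides are continuous in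
the directions, so the inequality extends to the Fulton–MacPherson space. At a given point of
that space the lifts can be chosen nonzero; then the left side is positive, because the points
`x_{i,j}` and `x_{j,i}` of `𝕜P^1` come from antipodes and are distinct. Hence the lines `ℓ_i` are
projectively independent at every point of `FM_d(n)` (`IsLiftable.linearIndependent_weightedPoly`).

To deduce the `E_d` conjecture, take `p` in `FM_d(n)` and arbitrary configurations `q_i` of `k_i`
points in `ℝ^d`. The lines of `γ(p; q_1, …, q_n)` are `a_i ℓ_a(q_i)` (`weightedPoly_comp`), and they
are independent by the above. So the spaces `a_i 𝕜[t]_{< k_i}` form a direct sum, and independence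
persists when the `ℓ_a(q_i)` are replaced by any other bases of the `𝕜[t]_{< k_i}`
(`linearIndependent_mul_exchange`, `nu_mem_FSub`).

Conversely, for `k_1 = ⋯ = k_n = 1` and points labelled by `1`, the labels of the composite are the
`ℓ_i(p)`, so the `E_d` conjecture contains the weak one.
-/

/-! ### Products over pairs of distinct indices -/

/-- The map on ordered pairs of distinct indices induced by an injection. -/
def Pairs.map {ι κ : Type*} (f : ι ↪ κ) (e : Pairs ι) : Pairs κ :=
  ⟨(f e.1.1, f e.1.2), fun h => e.2 (f.injective h)⟩

theorem Pairs.map_injective {ι κ : Type*} (f : ι ↪ κ) : Function.Injective (Pairs.map f) := by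
  rintro ⟨⟨a, b⟩, h⟩ ⟨⟨a', b'⟩, h'⟩ he
  simpa [Pairs.map] using he

theorem Pairs.prod_eq {ι M : Type*} [Fintype ι] [DecidableEq ι] [CommMonoid M] (f : Pairs ι → M) :
    ∏ i : ι, ∏ j : {j : ι // j ≠ i}, f ⟨(i, j), j.2.symm⟩ = ∏ e : Pairs ι, f e := by
  rw [← Fintype.prod_sigma' (fun (i : ι) (j : {j : ι // j ≠ i}) => f ⟨(i, j), j.2.symm⟩)]
  exact Fintype.prod_bijective (fun z : Σ i : ι, {j : ι // j ≠ i} =>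
    (⟨(z.1, z.2.1), z.2.2.symm⟩ : Pairs ι))
    ⟨by rintro ⟨i, j, h⟩ ⟨i', j', h'⟩ he; simp at he; obtain ⟨rfl, rfl⟩ := he; rfl,
     by rintro ⟨⟨i, j⟩, h⟩; exact ⟨⟨i, j, Ne.symm h⟩, rfl⟩⟩ _ _ fun _ => rfl

/-- Every ordered pair of distinct indices lies in exactly one set of two indices. -/
theorem Pairs.prod_powersetCard_two {n : ℕ} {M : Type*} [CommMonoid M] (f : Pairs (Fin n) → M) :
    ∏ I ∈ (Finset.univ : Finset (Fin n)).powersetCard 2,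
      ∏ e : Pairs (Fin I.card), f (e.map (I.orderEmbOfFin rfl).toEmbedding) =
    ∏ e : Pairs (Fin n), f e := by
  have hcard : ∀ e : Pairs (Fin n), ({e.1.1, e.1.2} : Finset (Fin n)).card = 2 :=
    fun e => Finset.card_pair e.2
  rw [← Finset.prod_fiberwise_of_maps_to
    (t := (Finset.univ : Finset (Fin n)).powersetCard 2)
    (g := fun e : Pairs (Fin n) => ({e.1.1, e.1.2} : Finset (Fin n)))
    (fun e _ => Finset.mem_powersetCard.2 ⟨Finset.subset_univ _, hcard e⟩)]
  refine Finset.prod_congr rfl fun I hI => ?_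
  rw [Finset.mem_powersetCard] at hI
  refine Finset.prod_bij (fun e _ => e.map (I.orderEmbOfFin rfl).toEmbedding) ?_ ?_ ?_ ?_
  · intro e _
    refine Finset.mem_filter.2 ⟨Finset.mem_univ _, Finset.eq_of_subset_of_card_le ?_ ?_⟩
    · intro a ha
      simp only [Pairs.map, Finset.mem_insert, Finset.mem_singleton] at ha
      rcases ha with rfl | rfl
      · exact Finset.orderEmbOfFin_mem I rfl e.1.1
      · exact Finset.orderEmbOfFin_mem I rfl e.1.2
    · rw [hcard, hI.2]
  · exact fun a _ b _ h => Pairs.map_injective _ h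
  · rintro ⟨⟨a, b⟩, hab⟩ he
    have he := (Finset.mem_filter.1 he).2
    dsimp only at he
    have hr : ∀ a ∈ I, ∃ i, I.orderEmbOfFin rfl i = a := fun a ha => by
      have : a ∈ Set.range (I.orderEmbOfFin rfl) := by simpa using ha
      exact this
    obtain ⟨i, hi⟩ := hr a (by rw [← he]; simp)
    obtain ⟨j, hj⟩ := hr b (by rw [← he]; simp)
    refine ⟨⟨(i, j), ?_⟩, Finset.mem_univ _, ?_⟩
    · rintro h
      exact hab (hi.symm.trans ((congrArg _ h).trans hj))
    · exact Subtype.ext (Prod.ext hi hj)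
  · exact fun _ _ => rfl

/-! ### Projective independence and linear independence -/

section Independence

variable {K V : Type*} [Field K] [AddCommGroup V] [Module K V]

theorem Projectivization.independent_mk_iff {ι : Type*} (f : ι → V) (hf : ∀ i, f i ≠ 0) :
    Projectivization.Independent (fun i => Projectivization.mk K (f i) (hf i)) ↔
      LinearIndependent K f := by
  refine ⟨fun h => ?_, fun h => .mk f hf h⟩
  rw [Projectivization.independent_iff] at h
  choose a ha using fun i => Projectivization.exists_smul_eq_mk_rep K (f i) (hf i)
  have := h.units_smul fun i => (a i)⁻¹
  convert this using 1
  funext i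
  simp [← ha]

theorem Projectivization.Independent.comp {ι κ : Type*} {f : ι → Projectivization K V}
    (h : Projectivization.Independent f) {g : κ → ι} (hg : Function.Injective g) :
    Projectivization.Independent (f ∘ g) :=
  Projectivization.independent_iff.2 ((Projectivization.independent_iff.1 h).comp g hg)

end Independence

/-- The multiples `g i * V i` of finite-dimensional subspaces `V i` span their direct sum as soon as
this can be tested on one family of bases; hence bases of the `V i` may be exchanged. -/
theorem linearIndependent_mul_exchange {𝕜 A ι : Type*} [Field 𝕜] [CommRing A] [Algebra 𝕜 A]
    [Fintype ι] {κ : ι → Type*} [∀ i, Fintype (κ i)] (V : ι → Submodule 𝕜 A)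
    [∀ i, FiniteDimensional 𝕜 (V i)] (hV : ∀ i, Fintype.card (κ i) = Module.finrank 𝕜 (V i))
    (g : ι → A) (m y : ∀ i, κ i → A) (hm : ∀ i a, m i a ∈ V i) (hy : ∀ i a, y i a ∈ V i)
    (hyi : ∀ i, LinearIndependent 𝕜 (y i))
    (h : LinearIndependent 𝕜 fun z : Σ i, κ i => g z.1 * m z.1 z.2) :
    LinearIndependent 𝕜 fun z : Σ i, κ i => g z.1 * y z.1 z.2 := by
  classical
  have hmi : ∀ i, LinearIndependent 𝕜 (m i) := fun i =>
    LinearIndependent.of_comp (LinearMap.mulLeft 𝕜 (g i))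
      (h.comp (fun a => (⟨i, a⟩ : Σ i, κ i)) sigma_mk_injective)
  have key : ∀ f : ∀ i, κ i → A, (∀ i, LinearIndependent 𝕜 (f i)) → ∀ hf : ∀ i a, f i a ∈ V i,
      ∃ b : ∀ i, Module.Basis (κ i) 𝕜 (V i), ∀ i a, (b i a : A) = f i a := by
    intro f hfi hf
    have hl : ∀ i, LinearIndependent 𝕜 fun a => (⟨f i a, hf i a⟩ : V i) := fun i =>
      LinearIndependent.of_comp (V i).subtype (hfi i)
    refine ⟨fun i => Module.Basis.mk (hl i) ?_, fun i a => by simp⟩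
    rw [(hl i).span_eq_top_of_card_eq_finrank' (hV i)]
  obtain ⟨b, hb⟩ := key m hmi hm
  obtain ⟨b', hb'⟩ := key y hyi hy
  let T : (∀ i, V i) →ₗ[𝕜] A :=
    ∑ i, LinearMap.mulLeft 𝕜 (g i) ∘ₗ (V i).subtype ∘ₗ LinearMap.proj i
  have hT : ∀ (B : ∀ i, Module.Basis (κ i) 𝕜 (V i)) (z : Σ i, κ i),
      T (Pi.basis B z) = g z.1 * B z.1 z.2 := by
    rintro B ⟨i, a⟩
    simp only [T, LinearMap.sum_apply, LinearMap.comp_apply, LinearMap.proj_apply,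
      LinearMap.mulLeft_apply, Pi.basis_apply, Submodule.subtype_apply]
    rw [Finset.sum_eq_single i]
    · simp
    · intro j _ hj
      simp [Pi.single_eq_of_ne hj]
    · simp
  have hker : LinearMap.ker T = ⊥ := by
    refine LinearMap.ker_eq_bot.2 ?_
    have h1 : LinearIndependent 𝕜 (T ∘ Pi.basis b) := by
      convert h using 1
      funext z
      rw [Function.comp_apply, hT, hb]
    rw [← LinearMap.ker_eq_bot]
    refine (Submodule.eq_bot_iff _).2 fun v hv => ?_
    rw [LinearMap.mem_ker, ← (Pi.basis b).sum_repr v, map_sum] at hv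
    have h2 := Fintype.linearIndependent_iff.1 h1 (fun z => (Pi.basis b).repr v z)
      (by simpa using hv)
    exact (Pi.basis b).ext_elem fun z => by simpa using h2 z
  have h3 : (fun z : Σ i, κ i => g z.1 * y z.1 z.2) = T ∘ Pi.basis b' :=
    funext fun z => by rw [Function.comp_apply, hT, hb']
  rw [h3]
  exact (Pi.basis b').linearIndependent.map' T hker

/-! ### The polynomials attached to a system of directions -/

section Polys

variable {𝕜 : Type*} [Field 𝕜] {E : Type*} [NormedAddCommGroup E] [NormedSpace ℝ E]
  (s : USphere E → OnePoint 𝕜)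

/-- The polynomial `∏_{j ≠ i} u_{i,j}^{w_j}` representing the `i`-th component of the weighted
Atiyah map of a system `x` of directions. -/
noncomputable def weightedPoly {n : ℕ} (w : Fin n → ℕ) (x : Pairs (Fin n) → USphere E) (i : Fin n) : 𝕜[X] :=
  ∏ j : {j : Fin n // j ≠ i}, rootPoly (s (x ⟨(i, j), j.2.symm⟩)) ^ w j

theorem weightedPoly_ne_zero {n : ℕ} (w : Fin n → ℕ) (x : Pairs (Fin n) → USphere E) (i : Fin n) :
    weightedPoly s w x i ≠ 0 :=
  Finset.prod_ne_zero_iff.2 fun _ _ => pow_ne_zero _ (rootPoly_ne_zero _)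

theorem PInf.mk_pow (f : 𝕜[X]) (hf : f ≠ 0) (k : ℕ) :
    (Projectivization.mk 𝕜 f hf : PInf 𝕜) ^ k = Projectivization.mk 𝕜 (f ^ k) (pow_ne_zero k hf) := by
  induction k with
  | zero => simp only [pow_zero]; rfl
  | succ k ih => simp only [pow_succ, ih, PInf.mk_mul_mk]

theorem PInf.mk_prod {ι : Type*} (S : Finset ι) (f : ι → 𝕜[X]) (hf : ∀ i, f i ≠ 0) :
    ∏ i ∈ S, (Projectivization.mk 𝕜 (f i) (hf i) : PInf 𝕜) =
      Projectivization.mk 𝕜 (∏ i ∈ S, f i) (Finset.prod_ne_zero_iff.2 fun i _ => hf i) := by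
  classical
  induction S using Finset.induction_on with
  | empty => simp only [Finset.prod_empty]; rfl
  | insert a S ha ih => simp only [Finset.prod_insert ha, ih, PInf.mk_mul_mk]

theorem weightedLines_eq_mk {n : ℕ} (w : Fin n → ℕ) (x : Pairs (Fin n) → USphere E) (i : Fin n) :
    weightedLines s w x i =
      Projectivization.mk 𝕜 (weightedPoly s w x i) (weightedPoly_ne_zero s w x i) := by
  simp only [weightedLines, rootLine, PInf.mk_pow]
  exact PInf.mk_prod _ _ _

theorem natDegree_rootPoly_le (z : OnePoint 𝕜) : (rootPoly z).natDegree ≤ 1 := by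
  cases z with
  | infty => exact natDegree_one.le.trans zero_le_one
  | coe z => exact (natDegree_X_sub_C z).le

theorem natDegree_weightedPoly_add_le {n : ℕ} (w : Fin n → ℕ) (x : Pairs (Fin n) → USphere E)
    (i : Fin n) : (weightedPoly s w x i).natDegree + w i ≤ ∑ j, w j := by
  have h1 : (weightedPoly s w x i).natDegree ≤ ∑ j : {j : Fin n // j ≠ i}, w j := by
    refine (natDegree_prod_le _ _).trans (Finset.sum_le_sum fun j _ => ?_)
    refine natDegree_pow_le.trans ?_
    simpa using Nat.mul_le_mul_left (w j) (natDegree_rootPoly_le (s (x ⟨(i, j), j.2.symm⟩)))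
  have h2 : ∑ j : {j : Fin n // j ≠ i}, w j = ∑ j ∈ Finset.univ.erase i, w j :=
    (Finset.sum_subtype _ (by simp) w).symm
  rw [← Finset.sum_erase_add _ _ (Finset.mem_univ i), ← h2]
  exact Nat.add_le_add_right h1 _

theorem mul_mem_degreeLT {f g : 𝕜[X]} {m k : ℕ} (hg : g ∈ degreeLT 𝕜 k)
    (h : f.natDegree + k ≤ m) : f * g ∈ degreeLT 𝕜 m := by
  rw [mem_degreeLT] at hg ⊢
  rcases eq_or_ne g 0 with rfl | hg0
  · simp
  rcases eq_or_ne f 0 with rfl | hf0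
  · simp
  rw [degree_eq_natDegree hg0, Nat.cast_lt] at hg
  rw [degree_eq_natDegree (mul_ne_zero hf0 hg0), natDegree_mul hf0 hg0, Nat.cast_lt]
  omega

theorem weightedPoly_one_mem_degreeLT {n : ℕ} (x : Pairs (Fin n) → USphere E) (i : Fin n) :
    weightedPoly s (fun _ => 1) x i ∈ degreeLT 𝕜 n := by
  have h := natDegree_weightedPoly_add_le s (fun _ => 1) x i
  rw [mem_degreeLT, degree_eq_natDegree (weightedPoly_ne_zero _ _ _ _), Nat.cast_lt]
  simp at h
  omega

theorem mk_mem_PFin {n : ℕ} {f : 𝕜[X]} (hf : f ≠ 0) :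
    Projectivization.mk 𝕜 f hf ∈ PFin 𝕜 n ↔ f ∈ degreeLT 𝕜 n := by
  simp [PFin, Projectivization.submodule_mk, Submodule.span_singleton_le_iff_mem]

theorem mem_PFin_iff {n : ℕ} {x : PInf 𝕜} : x ∈ PFin 𝕜 n ↔ x.rep ∈ degreeLT 𝕜 n := by
  rw [← mk_mem_PFin x.rep_nonzero, Projectivization.mk_rep]

/-- The lines of a composite configuration: the factors with second index in the block of `(i, a)`
are those of the `i`-th inner configuration, and each other block `h` contributes `k_h` copies of
the factor of the outer configuration at `(i, h)`. -/
theorem weightedPoly_comp {n : ℕ} (k : Fin n → ℕ) (p : FM E (Fin n)) (q : ∀ i, FM E (Fin (k i)))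
    (i : Fin n) (a : Fin (k i)) :
    weightedPoly s (fun _ => 1)
        ((p.comp q).reindex finSigmaFinEquiv.symm.toEmbedding).dir (finSigmaFinEquiv ⟨i, a⟩) =
      weightedPoly s k p.dir i * weightedPoly s (fun _ => 1) (q i).dir a := by
  classical
  -- Products over `j ≠ i` are rewritten as products over all `j`, to make them reindexable.
  have hsub : ∀ {ι : Type} [Fintype ι] [DecidableEq ι] (i : ι) (f : {j : ι // j ≠ i} → 𝕜[X]),
      ∏ j, f j = ∏ j, if h : j ≠ i then f ⟨j, h⟩ else 1 := by
    intro ι _ _ i f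
    rw [← Fintype.prod_subtype_mul_prod_subtype (fun j => j ≠ i)]
    rw [Finset.prod_congr rfl fun (j : {j // j ≠ i}) _ => dif_pos j.2,
      Finset.prod_congr rfl fun (j : {j // ¬j ≠ i}) _ => dif_neg j.2, Finset.prod_const_one, mul_one]
  have hdir : ∀ (z z' : Σ i, Fin (k i)) (h : finSigmaFinEquiv z ≠ finSigmaFinEquiv z')
      (h' : z ≠ z'), ((p.comp q).reindex finSigmaFinEquiv.symm.toEmbedding).dir
        ⟨(finSigmaFinEquiv z, finSigmaFinEquiv z'), h⟩ = (p.comp q).dir ⟨(z, z'), h'⟩ := by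
    intro z z' h h'
    refine congrArg (p.comp q).dir (Subtype.ext ?_)
    simp
  simp only [weightedPoly, pow_one]
  rw [hsub, hsub, hsub, ← finSigmaFinEquiv.prod_comp, Fintype.prod_sigma]
  rw [← Finset.mul_prod_erase _ _ (Finset.mem_univ i), mul_comm]
  congr 1
  · rw [← Finset.mul_prod_erase _ _ (Finset.mem_univ i), dif_neg (by simp), one_mul]
    refine Finset.prod_congr rfl fun h hh => ?_
    have hne : h ≠ i := Finset.ne_of_mem_erase hh
    rw [dif_pos hne]
    rw [Finset.prod_congr rfl (g := fun _ => rootPoly (s (p.dir ⟨(i, h), hne.symm⟩)))]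
    · simp
    · intro b _
      rw [dif_pos (by simp [hne]), hdir _ _ _ (by simp [hne.symm])]
      simp [FM.dir, FM.comp, Amb.comp, hne]
  · refine Finset.prod_congr rfl fun b _ => ?_
    by_cases hb : b = a
    · simp [hb]
    · rw [dif_pos (by simpa using hb), dif_pos hb, hdir _ _ _ (by simpa using Ne.symm hb)]
      simp [FM.dir, FM.comp, Amb.comp]

end Polys

/-! ### The determinant inequality on the Fulton–MacPherson space -/

section ScaledDet

variable {𝕜 : Type*} [Field 𝕜] {E : Type*} [NormedAddCommGroup E] [NormedSpace ℝ E]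
  (s : USphere E → OnePoint 𝕜)

/-- The determinant of the coefficients of `∏_{j ≠ i} c_{i,j} u_{i,j}`: the determinant `φ` of a
system `x` of directions, computed with the representatives `c_{i,j} u_{i,j}` of the points of
`𝕜P^1` instead of the `u_{i,j}`. -/
noncomputable def scaledDet {n : ℕ} (c : Pairs (Fin n) → 𝕜) (x : Pairs (Fin n) → USphere E) : 𝕜 :=
  (Matrix.of fun a i : Fin n => (∏ j : {j : Fin n // j ≠ i},
    (C (c ⟨(i, j), j.2.symm⟩) * rootPoly (s (x ⟨(i, j), j.2.symm⟩)))).coeff a).det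

theorem scaledDet_eq {n : ℕ} (c : Pairs (Fin n) → 𝕜) (x : Pairs (Fin n) → USphere E) :
    scaledDet s c x = (∏ e, c e) *
      (Matrix.of fun a i : Fin n => (weightedPoly s (fun _ => 1) x i).coeff a).det := by
  rw [← Pairs.prod_eq, ← Matrix.det_mul_row]
  refine congrArg Matrix.det (Matrix.ext fun a i => ?_)
  simp only [Matrix.of_apply, weightedPoly, pow_one, Finset.prod_mul_distrib]
  rw [← map_prod C, coeff_C_mul]

theorem scaledDet_confDir {n : ℕ} (c : Pairs (Fin n) → 𝕜) (p : Conf E (Fin n)) :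
    scaledDet s c (confDir p) = (∏ e, c e) * phi s p := by
  rw [scaledDet_eq]
  simp only [weightedPoly, pow_one]
  rfl

theorem linearIndependent_weightedPoly_of_scaledDet_ne_zero {n : ℕ} {c : Pairs (Fin n) → 𝕜}
    {x : Pairs (Fin n) → USphere E} (h : scaledDet s c x ≠ 0) :
    LinearIndependent 𝕜 (weightedPoly s (fun _ => 1) x) := by
  rw [scaledDet_eq] at h
  have h := Matrix.linearIndependent_cols_of_det_ne_zero (right_ne_zero_of_mul h)
  refine LinearIndependent.of_comp
    (LinearMap.pi fun a : Fin n => lcoeff 𝕜 (a : ℕ)) ?_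
  exact h

/-- Two distinct points of `𝕜P^1` are projectively independent. -/
theorem scaledDet_ne_zero_of_card_two {n : ℕ} (hn : n = 2) {c : Pairs (Fin n) → 𝕜}
    {x : Pairs (Fin n) → USphere E} (hc : ∀ e, c e ≠ 0)
    (hx : ∀ e : Pairs (Fin n), s (x ⟨(e.1.2, e.1.1), e.2.symm⟩) ≠ s (x e)) :
    scaledDet s c x ≠ 0 := by
  subst hn
  rw [scaledDet_eq]
  refine mul_ne_zero (Finset.prod_ne_zero_iff.2 fun e _ => hc e) ?_
  have h0 : weightedPoly s (fun _ => 1) x 0 = rootPoly (s (x ⟨(0, 1), by decide⟩)) := by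
    rw [weightedPoly, Fintype.prod_eq_single ⟨1, by decide⟩, pow_one]
    rintro ⟨j, hj⟩ hj'
    exact absurd (Subtype.ext (show j = 1 by omega)) hj'
  have h1 : weightedPoly s (fun _ => 1) x 1 = rootPoly (s (x ⟨(1, 0), by decide⟩)) := by
    rw [weightedPoly, Fintype.prod_eq_single ⟨0, by decide⟩, pow_one]
    rintro ⟨j, hj⟩ hj'
    exact absurd (Subtype.ext (show j = 0 by omega)) hj'
  have hne := hx ⟨(0, 1), by decide⟩
  rw [Matrix.det_fin_two]
  simp only [Matrix.of_apply, h0, h1]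
  generalize s (x ⟨(0, 1), _⟩) = y at *
  generalize s (x ⟨(1, 0), _⟩) = z at *
  cases y with
  | infty =>
    cases z with
    | infty => exact absurd rfl hne
    | coe z => simp [rootPoly, coeff_one, coeff_X, coeff_C]
  | coe y =>
    cases z with
    | infty => simp [rootPoly, coeff_one, coeff_X, coeff_C]
    | coe z =>
      have : z - y ≠ 0 := sub_ne_zero.2 fun h => hne (congrArg _ h)
      have e : (-y) * 1 - (-z) * 1 = z - y := by ring
      simpa [rootPoly, coeff_one, coeff_X, coeff_C, e, neg_add_eq_sub] using this

end ScaledDet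

section Closure

variable {𝕜 : Type*} [NormedField 𝕜] {E : Type*} [NormedAddCommGroup E] [NormedSpace ℝ E]

theorem continuous_coeff_prod {X ι : Type*} [TopologicalSpace X] (S : Finset ι) (f : ι → X → 𝕜[X])
    (hf : ∀ i ∈ S, ∀ k, Continuous fun x => (f i x).coeff k) (k : ℕ) :
    Continuous fun x => (∏ i ∈ S, f i x).coeff k := by
  classical
  induction S using Finset.induction_on generalizing k with
  | empty => simpa using continuous_const
  | insert a S ha ih =>
    simp only [Finset.prod_insert ha, coeff_mul]
    exact continuous_finsetSum _ fun m _ => (hf a (by simp) m.1).mul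
      (ih (fun i hi => hf i (by simp [hi])) m.2)

/-- The map `s` to `𝕜P^1` admits two lifts `c true • u` and `c false • u` to `𝕜[t]`, defined and
continuous on the whole sphere, that do not vanish simultaneously; and `s` separates antipodes. -/
structure IsLiftable (s : USphere E → OnePoint 𝕜) (c : Bool → USphere E → 𝕜) : Prop where
  continuous_coeff : ∀ b k, Continuous fun x => (C (c b x) * rootPoly (s x)).coeff k
  exists_ne_zero : ∀ x, ∃ b, c b x ≠ 0
  ne_antipode : ∀ x y : USphere E, (y : E) = -(x : E) → s y ≠ s x

variable {s : USphere E → OnePoint 𝕜} {c : Bool → USphere E → 𝕜}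

theorem IsLiftable.continuous_scaledDet (hs : IsLiftable s c) {n : ℕ} (b : Pairs (Fin n) → Bool) :
    Continuous fun x : Pairs (Fin n) → USphere E => scaledDet s (fun e => c (b e) (x e)) x := by
  unfold scaledDet
  refine Continuous.matrix_det (continuous_matrix fun a i => ?_)
  simp only [Matrix.of_apply]
  refine continuous_coeff_prod Finset.univ (fun (j : {j : Fin n // j ≠ i}) (x : Pairs (Fin n) → USphere E) =>
    C (c (b ⟨(i, j), j.2.symm⟩) (x ⟨(i, j), j.2.symm⟩)) *
      rootPoly (s (x ⟨(i, j), j.2.symm⟩))) (fun j _ k => ?_) a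
  exact (hs.continuous_coeff (b ⟨(i, j), j.2.symm⟩) k).comp (continuous_apply _)

/-- The bound `|D| ≥ 1`, cleared of denominators and written with arbitrary representatives of the
points of `𝕜P^1`. In this form both sides are continuous in the directions. -/
theorem prod_norm_scaledDet_confDir_le (hD : ∀ (n : ℕ) (p : Conf E (Fin n)), 1 ≤ ‖normDet s p‖) {n : ℕ}
    (p : Conf E (Fin n)) (c : Pairs (Fin n) → 𝕜) :
    ∏ I ∈ (Finset.univ : Finset (Fin n)).powersetCard 2,
      ‖scaledDet s (fun e => c (e.map (I.orderEmbOfFin rfl).toEmbedding))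
        (fun e => confDir p (e.map (I.orderEmbOfFin rfl).toEmbedding))‖ ≤
    ‖scaledDet s c (confDir p)‖ := by
  have h1 : ∀ I : Finset (Fin n),
      scaledDet s (fun e => c (e.map (I.orderEmbOfFin rfl).toEmbedding))
        (fun e => confDir p (e.map (I.orderEmbOfFin rfl).toEmbedding)) =
      (∏ e : Pairs (Fin I.card), c (e.map (I.orderEmbOfFin rfl).toEmbedding)) * phiSub s p I :=
    fun I => scaledDet_confDir s _ ((I.orderEmbOfFin rfl).toEmbedding.trans p)
  simp only [h1, scaledDet_confDir]
  rw [← norm_prod, Finset.prod_mul_distrib, Pairs.prod_powersetCard_two, norm_mul, norm_mul]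
  refine mul_le_mul_of_nonneg_left ?_ (norm_nonneg _)
  have h := hD n p
  rw [normDet, norm_div] at h
  -- The denominator cannot vanish, since otherwise the quotient would be `0`.
  rcases (norm_nonneg (∏ I ∈ (Finset.univ : Finset (Fin n)).powersetCard 2,
    phiSub s p I)).eq_or_lt with h0 | h0
  · rw [← h0, div_zero] at h
    exact absurd h (by norm_num)
  · exact (one_le_div h0).1 h

theorem FM.dir_mem_of_isClosed {n : ℕ} {S : Set (Pairs (Fin n) → USphere E)} (hS : IsClosed S)
    (h : ∀ P : Conf E (Fin n), confDir P ∈ S) (p : FM E (Fin n)) : p.dir ∈ S :=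
  closure_minimal (t := Prod.fst ⁻¹' S) (by rintro _ ⟨P, rfl⟩; exact h P)
    (hS.preimage continuous_fst) p.2

theorem FM.dir_swap {n : ℕ} (p : FM E (Fin n)) (e : Pairs (Fin n)) :
    (p.dir ⟨(e.1.2, e.1.1), e.2.symm⟩ : E) = -(p.dir e : E) := by
  have hS : IsClosed {x : Pairs (Fin n) → USphere E |
      (x ⟨(e.1.2, e.1.1), e.2.symm⟩ : E) = -(x e : E)} :=
    isClosed_eq (by fun_prop) (by fun_prop)
  refine FM.dir_mem_of_isClosed hS (fun P => ?_) p
  simp only [Set.mem_ofPred_eq, confDir]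
  rw [← smul_neg, neg_sub, norm_sub_rev]

/-- The cleared form of `|D| ≥ 1` persists on the Fulton–MacPherson space, for either choice of lift
at each pair. -/
theorem IsLiftable.prod_norm_scaledDet_le (hs : IsLiftable s c)
    (hD : ∀ (n : ℕ) (p : Conf E (Fin n)), 1 ≤ ‖normDet s p‖) {n : ℕ} (p : FM E (Fin n))
    (b : Pairs (Fin n) → Bool) :
    ∏ I ∈ (Finset.univ : Finset (Fin n)).powersetCard 2,
      ‖scaledDet s (fun e => c (b (e.map (I.orderEmbOfFin rfl).toEmbedding))
          (p.dir (e.map (I.orderEmbOfFin rfl).toEmbedding)))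
        (fun e => p.dir (e.map (I.orderEmbOfFin rfl).toEmbedding))‖ ≤
    ‖scaledDet s (fun e => c (b e) (p.dir e)) p.dir‖ := by
  have hG : Continuous fun x : Pairs (Fin n) → USphere E =>
      ∏ I ∈ (Finset.univ : Finset (Fin n)).powersetCard 2,
        ‖scaledDet s (fun e => c (b (e.map (I.orderEmbOfFin rfl).toEmbedding))
            (x (e.map (I.orderEmbOfFin rfl).toEmbedding)))
          (fun e => x (e.map (I.orderEmbOfFin rfl).toEmbedding))‖ := by
    refine continuous_finsetProd _ fun I _ => Continuous.norm ?_
    have hr : Continuous fun (x : Pairs (Fin n) → USphere E) (e : Pairs (Fin I.card)) =>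
        x (e.map (I.orderEmbOfFin rfl).toEmbedding) := by fun_prop
    have h := hs.continuous_scaledDet (n := I.card)
      fun e => b (e.map (I.orderEmbOfFin rfl).toEmbedding)
    simpa only [Function.comp_def] using h.comp hr
  exact FM.dir_mem_of_isClosed (isClosed_le hG (hs.continuous_scaledDet b).norm)
    (fun P => prod_norm_scaledDet_confDir_le hD P fun e => c (b e) (confDir P e)) p

/-- If `|D| ≥ 1` on configurations, the lines of every point of the Fulton–MacPherson space are
projectively independent. -/
theorem IsLiftable.linearIndependent_weightedPoly (hs : IsLiftable s c)
    (hD : ∀ (n : ℕ) (p : Conf E (Fin n)), 1 ≤ ‖normDet s p‖) {n : ℕ} (p : FM E (Fin n)) :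
    LinearIndependent 𝕜 (weightedPoly s (fun _ => 1) p.dir) := by
  -- For each pair, a lift that is nonzero at the direction of `p` makes the lower bound positive.
  choose b hb using fun e => hs.exists_ne_zero (p.dir e)
  refine linearIndependent_weightedPoly_of_scaledDet_ne_zero s
    (norm_pos_iff.1 (lt_of_lt_of_le (Finset.prod_pos fun I hI => norm_pos_iff.2 ?_)
      (hs.prod_norm_scaledDet_le hD p b)))
  exact scaledDet_ne_zero_of_card_two s (Finset.mem_powersetCard.1 hI).2 (fun e => hb _)
    fun e => hs.ne_antipode _ _ (p.dir_swap (e.map (I.orderEmbOfFin rfl).toEmbedding))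

end Closure

/-! ### Lifts of the stereographic projections -/

section Lifts

variable {𝕜 : Type*} [NormedField 𝕜] [CharZero 𝕜] {E : Type*} [NormedAddCommGroup E]

open Classical in
/-- Stereographic projection `x ↦ w / (1 - z)` has the lifts `(1 - z) t - w` and `w' t - (1 + z)`,
where `w w' = 1 - z²`. The first one vanishes at the north pole only, where the second is `-2`. -/
theorem isLiftable_of_stereographic [NormedSpace ℝ E] (s : USphere E → OnePoint 𝕜)
    (w w' z : USphere E → 𝕜)
    (hw : Continuous w) (hw' : Continuous w') (hz : Continuous z)
    (hwz : ∀ x, w x * w' x = 1 - z x ^ 2) (hpole : ∀ x, z x = 1 → w x = 0 ∧ w' x = 0)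
    (hwneg : ∀ x y : USphere E, (y : E) = -(x : E) → w y = -w x ∧ z y = -z x)
    (h1 : ∀ x, z x = 1 → s x = OnePoint.infty)
    (h2 : ∀ x, z x ≠ 1 → s x = ((w x / (1 - z x) : 𝕜) : OnePoint 𝕜)) :
    IsLiftable s (fun b x => if b then 1 - z x else if z x = 1 then -2 else w' x) := by
  have hrep : ∀ x, C (1 - z x) * rootPoly (s x) = C (1 - z x) * X - C (w x) ∧
      C (if z x = 1 then -2 else w' x) * rootPoly (s x) = C (w' x) * X - C (1 + z x) := by
    intro x
    by_cases hx : z x = 1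
    · rw [h1 x hx, hx, (hpole x hx).1, (hpole x hx).2]
      refine ⟨by simp, ?_⟩
      simp only [rootPoly, if_true, mul_one, map_zero, zero_mul, zero_sub, ← map_neg]
      norm_num
    · have hx' : 1 - z x ≠ 0 := sub_ne_zero.2 (Ne.symm hx)
      rw [h2 x hx, if_neg hx]
      simp only [rootPoly, mul_sub, ← map_mul]
      refine ⟨by rw [mul_div_cancel₀ _ hx'], ?_⟩
      congr 2
      rw [← mul_div_assoc, div_eq_iff hx', mul_comm, hwz]
      ring
  refine ⟨?_, ?_, ?_⟩
  · rintro (_ | _) k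
    · simp only [Bool.false_eq_true, if_false, (hrep _).2, coeff_sub, coeff_C_mul, coeff_C]
      split_ifs <;> fun_prop
    · simp only [if_true, (hrep _).1, coeff_sub, coeff_C_mul, coeff_C]
      split_ifs <;> fun_prop
  · intro x
    by_cases hx : z x = 1
    · exact ⟨false, by simp [hx]⟩
    · exact ⟨true, by simpa using sub_ne_zero.2 (Ne.symm hx)⟩
  · intro x y hxy
    obtain ⟨hw1, hz1⟩ := hwneg x y hxy
    by_cases hx : z x = 1
    · rw [h1 x hx, h2 y (by rw [hz1, hx]; norm_num)]
      exact OnePoint.coe_ne_infty _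
    · by_cases hy : z y = 1
      · rw [h1 y hy, h2 x hx]
        exact OnePoint.infty_ne_coe _
      · rw [h2 y hy, h2 x hx, Ne, OnePoint.coe_eq_coe, hw1]
        intro h
        rw [hz1] at h hy
        have hx' : 1 - z x ≠ 0 := sub_ne_zero.2 (Ne.symm hx)
        have hy' : 1 - -z x ≠ 0 := sub_ne_zero.2 (Ne.symm hy)
        rw [div_eq_div_iff hy' hx'] at h
        have h0 : 2 * w x = 0 := by linear_combination -h
        have h0 : w x = 0 := by simpa using h0
        have h3 := hwz x
        rw [h0, zero_mul] at h3
        exact mul_ne_zero hx' hy' (by linear_combination -h3)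

end Lifts

theorem stereoC_isLiftable : ∃ c, IsLiftable stereoC c := by
  refine ⟨_, isLiftable_of_stereographic stereoC
    (fun x => ((x.1 0 : ℝ) : ℂ) + (x.1 1 : ℝ) * Complex.I)
    (fun x => ((x.1 0 : ℝ) : ℂ) - (x.1 1 : ℝ) * Complex.I) (fun x => ((x.1 2 : ℝ) : ℂ))
    (by fun_prop) (by fun_prop) (by fun_prop) ?_ ?_ ?_ ?_ ?_⟩
  all_goals
    have hsph : ∀ x : USphere (EuclideanSpace ℝ (Fin 3)),
        x.1 0 ^ 2 + x.1 1 ^ 2 + x.1 2 ^ 2 = 1 := by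
      intro x
      have := EuclideanSpace.real_norm_sq_eq x.1
      rw [norm_eq_of_mem_sphere, Fin.sum_univ_three] at this
      linarith
  · intro x
    have h : ((x.1 0 : ℝ) : ℂ) ^ 2 + (x.1 1 : ℝ) ^ 2 + (x.1 2 : ℝ) ^ 2 = 1 := by
      simpa using congrArg Complex.ofReal (hsph x)
    linear_combination h - (x.1 1 : ℂ) ^ 2 * Complex.I_sq
  · intro x hx
    have h := hsph x
    rw [show x.1 2 = 1 by exact_mod_cast hx] at h
    have h0 : x.1 0 = 0 := by nlinarith [sq_nonneg (x.1 0), sq_nonneg (x.1 1)]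
    have h1 : x.1 1 = 0 := by nlinarith [sq_nonneg (x.1 0), sq_nonneg (x.1 1)]
    simp [h0, h1]
  · intro x y hxy
    simp only [hxy, PiLp.neg_apply, Complex.ofReal_neg, and_true]
    ring
  · intro x hx
    exact if_pos (by exact_mod_cast hx)
  · intro x hx
    exact if_neg (by exact_mod_cast hx)

theorem stereoR_isLiftable : ∃ c, IsLiftable stereoR c := by
  refine ⟨_, isLiftable_of_stereographic stereoR (fun x => x.1 0) (fun x => x.1 0)
    (fun x => x.1 1) (by fun_prop) (by fun_prop) (by fun_prop) ?_ ?_ ?_ ?_ ?_⟩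
  all_goals
    have hsph : ∀ x : USphere (EuclideanSpace ℝ (Fin 2)), x.1 0 ^ 2 + x.1 1 ^ 2 = 1 := by
      intro x
      have := EuclideanSpace.real_norm_sq_eq x.1
      rw [norm_eq_of_mem_sphere, Fin.sum_univ_two] at this
      linarith
  · intro x
    linear_combination hsph x
  · intro x hx
    have h := hsph x
    rw [show x.1 1 = 1 from hx] at h
    have h0 : x.1 0 = 0 := by nlinarith [sq_nonneg (x.1 0)]
    exact ⟨h0, h0⟩
  · intro x y hxy
    simp [hxy]
  · intro x hx
    exact if_pos hx
  · intro x hx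
    exact if_neg hx

/-! ### The action on projectively independent labels -/

section Action

theorem ExtSym.mk_mem_FSub_iff {𝕜 : Type*} [Field 𝕜] {n : ℕ} (p : FM RInf (Fin n))
    (x : Fin n → PInf 𝕜) : ExtSym.mk p x ∈ FSub 𝕜 n ↔
      (∀ i, x i ∈ PFin 𝕜 n) ∧ Projectivization.Independent x := by
  refine ⟨?_, fun h => ⟨p, x, rfl, h⟩⟩
  rintro ⟨q, y, h, hy, hyi⟩
  obtain ⟨σ, -, h2⟩ := Quotient.exact (s := extSymSetoid n (PInf 𝕜)) h.symm
  dsimp only at h2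
  subst h2
  exact ⟨fun i => hy _, hyi.comp σ.injective⟩

/-- If `|D| ≥ 1`, then `ν` preserves projective independence of the labels: it does for the labels
`ℓ_a(q_i)` of arbitrary configurations `q_i` of `k_i` points, since `a_i ℓ_a(q_i)` are the lines of
the composite `γ(p; q_1, …, q_n)`, and any independent labels span the same spaces. -/
theorem nu_mem_FSub {𝕜 : Type*} [NormedField 𝕜] {d : ℕ}
    [Infinite (EuclideanSpace ℝ (Fin d))]
    {s : USphere (EuclideanSpace ℝ (Fin d)) → OnePoint 𝕜} (hs : ∃ c, IsLiftable s c)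
    (hD : ∀ (n : ℕ) (p : Conf (EuclideanSpace ℝ (Fin d)) (Fin n)), 1 ≤ ‖normDet s p‖)
    (n : ℕ) (k : Fin n → ℕ) (p : FM (EuclideanSpace ℝ (Fin d)) (Fin n))
    (r : ∀ i, ExtSym (k i) (PInf 𝕜)) (hr : ∀ i, r i ∈ FSub 𝕜 (k i)) :
    nu s k p r ∈ FSub 𝕜 (∑ i, k i) := by
  obtain ⟨c, hs⟩ := hs
  choose q y hqy hy hyi using hr
  obtain rfl : r = fun i => ExtSym.mk (q i) (y i) := funext hqy
  rw [nu_mk, ExtSym.mk_mem_FSub_iff]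
  let q' : ∀ i, FM (EuclideanSpace ℝ (Fin d)) (Fin (k i)) := fun i =>
    FM.ofConf (Fin.valEmbedding.trans (Infinite.natEmbedding _))
  have hm := (hs.linearIndependent_weightedPoly hD
    ((p.comp q').reindex finSigmaFinEquiv.symm.toEmbedding)).comp
      (fun z : Σ i, Fin (k i) => finSigmaFinEquiv z) finSigmaFinEquiv.injective
  have hlab : ∀ z : Σ i, Fin (k i), weightedAtiyah s k p z.1 * y z.1 z.2 =
      Projectivization.mk 𝕜 (weightedPoly s k p.dir z.1 * (y z.1 z.2).rep)
        (mul_ne_zero (weightedPoly_ne_zero _ _ _ _) (y z.1 z.2).rep_nonzero) := fun z => by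
    rw [← PInf.mk_mul_mk _ _ (weightedPoly_ne_zero _ _ _ _) (y z.1 z.2).rep_nonzero,
      Projectivization.mk_rep, ← weightedLines_eq_mk]
    rfl
  have hfin : ∀ m, FiniteDimensional 𝕜 (degreeLT 𝕜 m) := fun m =>
    (degreeLTEquiv 𝕜 m).symm.finiteDimensional
  have hlin := linearIndependent_mul_exchange (fun i => degreeLT 𝕜 (k i))
    (fun i => by simp [(degreeLTEquiv 𝕜 (k i)).finrank_eq])
    (fun i => weightedPoly s k p.dir i) (fun i => weightedPoly s (fun _ => 1) (q' i).dir)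
    (fun i a => (y i a).rep) (fun i a => weightedPoly_one_mem_degreeLT s _ a)
    (fun i a => mem_PFin_iff.1 (hy i a)) (fun i => Projectivization.independent_iff.1 (hyi i))
    (by
      rw [show (fun z : Σ i, Fin (k i) => weightedPoly s k p.dir z.1 *
          weightedPoly s (fun _ => 1) (q' z.1).dir z.2) = _ from
        funext fun z => (weightedPoly_comp s k p q' z.1 z.2).symm]
      exact hm)
  simp only [preNu, hlab]
  refine ⟨fun m => ?_, ?_⟩
  · rw [Function.comp_apply, mk_mem_PFin]
    exact mul_mem_degreeLT (mem_PFin_iff.1 (hy _ _)) (natDegree_weightedPoly_add_le s k p.dir _)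
  · exact Projectivization.Independent.comp
      ((Projectivization.independent_mk_iff _ _).2 hlin) finSigmaFinEquiv.symm.injective

/-- The case `k_1 = ⋯ = k_n = 1` of the action, on points labelled by the unit of `𝕜P^∞`. -/
theorem independent_atiyahLines_of_nu_mem_FSub {𝕜 : Type*} [Field 𝕜] {d : ℕ}
    {s : USphere (EuclideanSpace ℝ (Fin d)) → OnePoint 𝕜}
    (h : ∀ (n : ℕ) (k : Fin n → ℕ) (p : FM (EuclideanSpace ℝ (Fin d)) (Fin n))
      (r : ∀ i, ExtSym (k i) (PInf 𝕜)), (∀ i, r i ∈ FSub 𝕜 (k i)) → nu s k p r ∈ FSub 𝕜 (∑ i, k i))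
    (n : ℕ) (p : Conf (EuclideanSpace ℝ (Fin d)) (Fin n)) :
    Projectivization.Independent (atiyahLines s p) := by
  let q : FM RInf (Fin 1) := FM.ofConf ⟨fun _ => 0, Function.injective_of_subsingleton _⟩
  have hone : ExtSym.mk q (fun _ => (1 : PInf 𝕜)) ∈ FSub 𝕜 1 := by
    refine (ExtSym.mk_mem_FSub_iff _ _).2 ⟨fun _ => ?_, ?_⟩
    · refine (mk_mem_PFin one_ne_zero).2 ?_
      rw [mem_degreeLT, degree_one]
      exact_mod_cast one_pos
    · exact (Projectivization.independent_mk_iff (fun _ : Fin 1 => (1 : 𝕜[X]))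
        fun _ => one_ne_zero).2 (LinearIndependent.of_subsingleton 0 one_ne_zero)
  have hnu := h n (fun _ => 1) (FM.ofConf p) (fun _ => ExtSym.mk q fun _ => 1) fun _ => hone
  rw [nu_mk, ExtSym.mk_mem_FSub_iff] at hnu
  have hi := hnu.2.comp (g := fun i => finSigmaFinEquiv (⟨i, 0⟩ : Σ _ : Fin n, Fin 1))
    (finSigmaFinEquiv.injective.comp fun i j hij => congrArg Sigma.fst hij)
  convert hi using 1
  funext i
  simp [preNu, atiyahLines, weightedAtiyah, FM.dir, FM.ofConf, confPt]

end Action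

/-! ### The implications between the conjectures -/

theorem mainTheorem2 :
    (StrongAtiyahSutcliffe → E3AtiyahSutcliffe) ∧
    (E3AtiyahSutcliffe → WeakAtiyahSutcliffe) ∧
    (StrongRealAtiyahSutcliffe → E2RealAtiyahSutcliffe) ∧
    (E2RealAtiyahSutcliffe → WeakRealAtiyahSutcliffe) := by
  have h3 : Infinite (EuclideanSpace ℝ (Fin 3)) := Module.Free.infinite ℝ _
  have h2 : Infinite (EuclideanSpace ℝ (Fin 2)) := Module.Free.infinite ℝ _
  exact ⟨nu_mem_FSub stereoC_isLiftable, independent_atiyahLines_of_nu_mem_FSub,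
    nu_mem_FSub stereoR_isLiftable, independent_atiyahLines_of_nu_mem_FSub⟩
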